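/- Let $n\ge 1$. Let $f:\mathbb{R}\times[0,\infty)\to\mathbb{R}$ be bounded and continuous, with $|f(r,q_1)-f(r,q_2)|\le\omega_f(|q_1-q_2|)$ for all $r\in\mathbb{R}$, $q_1,q_2\ge 0$ and some modulus of continuity $\omega_f$, nondecreasing in the first variable and strictly increasing in the second. Let $\mu(A)=\int_A\Theta\,dx$ for measurable $A\subset\mathbb{R}^n$, where $\Theta\in L^1(\mathbb{R}^n)$ and $\Theta>0$. Let $u_0:\mathbb{R}^n\to\mathbb{R}$ be uniformly continuous with $\lim_{R\to\infty}\inf\{u_0(y):|y|\ge R\}>u_0(x)$ for every $x\in\mathbb{R}^n$. For $A\subset\mathbb{R}^n$ put $\mathrm{sd}(x,A)=\mathrm{dist}(x,A)-\mathrm{dist}(x,\mathbb{R}^n\setminus A)\in[-\infty,\infty]$, with $\mathrm{dist}(x,\emptyset)=+\infty$, and for $h,s\in\mathbb{R}$ let $$D_h(s)=\{x:\mathrm{sd}(x,\{u_0<h\})<s\},\qquad E_h(s)=\{x:\mathrm{sd}(x,\{u_0\le h\})\le s\}.$$ For $W\in\{D,E\}$ consider the Lipschitz functions $\delta:[0,\infty)\to\mathbb{R}$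 with $\delta(0)=0$ and $$f\big(h,\mu(\mathrm{int}\,W_h(\delta(t)))\big)\le\delta'(t)\le f\big(h,\mu(\mathrm{cl}\,W_h(\delta(t)))\big)\quad\text{for a.e. }t\ge 0 .\qquad(*)_W$$ Suppose that $\overline h\in\mathbb{R}$ satisfies $f(\overline h,\mu(\{u_0<\overline h\}))\le 0\le f(\overline h,\mu(\{u_0\le\overline h\}))$. Then, for $h=\overline h$, $(*)_D$ has a minimal solution $\delta_D(\cdot,\overline h)$ (one that lies below every other solution at all times) and $(*)_E$ has a maximal solution $\delta_E(\cdot,\overline h)$, and the following holds. 1. If $$\limsup_{s\to0+}\frac{f(\overline h,\mu(D_{\overline h}(-s)))}{s^\alpha}\le -C\quad\text{for some }0<\alpha<1\text{ and }C>0,\qquad(1)$$ then $\delta_D(t,\overline h)<0\le\delta_E(t,\overline h)$ for all $t>0$. 2. If $$\liminf_{s\to0+}\frac{f(\overline h,\mu(E_{\overline h}(s)))}{s^\alpha}\ge C\quad\text{for some }0<\alpha<1\text{ and }C>0,\qquad(2)$$ then $\delta_D(t,\overline h)\le0<\delta_E(t,\overline h)$ for all $t>0$. 3. Let $u\in C(\mathbb{R}^n\times[0,\infty))$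 be the viscosity solution of $$u_t+|\nabla u|\,f\big(u,\mu(\{u(\cdot,t)<u(x,t)\})\big)=0\ \text{ in }\mathbb{R}^n\times(0,\infty),\qquad u(\cdot,0)=u_0,$$ such that for every $T>0$ there is $M_T>0$ with $|u(x,t)|\le M_T(|x|+1)$ on $\mathbb{R}^n\times[0,T]$. Here subsolutions are tested from above by $C^1$ functions with the nonlocal term $\mu(\{u(\cdot,t)<u(x,t)\})$, and supersolutions are tested from below with $\mu(\{u(\cdot,t)\le u(x,t)\})$. If (2) holds, or if (1) holds and $\{u_0\le\overline h\}$ has nonempty interior (which is automatic when $\{u_0<\overline h\}\ne\emptyset$), then the level set $\{x:u(x,t)=\overline h\}$ has nonempty interior for all $t>0$. -/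

import Mathlib

open Set Filter Topology MeasureTheory
open scoped NNReal ENNReal

noncomputable section

namespace NonlocalHJ

/-- Standing assumptions on the speed `f : ℝ × [0, ∞) → ℝ`: it is bounded and continuous, it has a
modulus of continuity in the second variable that is uniform in the first one, it is nondecreasing
in the first variable and strictly increasing in the second one. -/
structure IsAdmissibleSpeed (f : ℝ → ℝ≥0 → ℝ) : Prop where
  bounded : ∃ M : ℝ, ∀ r q, |f r q| ≤ M
  continuous : Continuous (Function.uncurry f)
  modulus : ∃ ω : ℝ≥0 → ℝ≥0, Monotone ω ∧ Tendsto ω (𝓝 0) (𝓝 0) ∧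
    ∀ r q₁ q₂, |f r q₁ - f r q₂| ≤ ω (nndist q₁ q₂)
  mono : ∀ r₁ r₂ q, r₁ < r₂ → f r₁ q ≤ f r₂ q
  strictMono : ∀ r q₁ q₂, q₁ < q₂ → f r q₁ < f r q₂

/-- Standing assumptions on the density `Θ`: it is in `L¹(ℝⁿ)` and positive. -/
structure IsAdmissibleDensity {n : ℕ} (Θ : EuclideanSpace ℝ (Fin n) → ℝ) : Prop where
  integrable : Integrable Θ volume
  pos : ∀ x, 0 < Θ x

/-- Standing assumptions on the initial value: `u₀` is uniformly continuous and
`lim_{R → ∞} inf {u₀ y : |y| ≥ R} > u₀ x` for every `x`. The limit may be `+∞`. -/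
structure IsAdmissibleInitial {n : ℕ} (u₀ : EuclideanSpace ℝ (Fin n) → ℝ) : Prop where
  uniformContinuous : UniformContinuous u₀
  coercive : ∃ L : EReal,
    Tendsto (fun R : ℝ => ⨅ y ∈ {y : EuclideanSpace ℝ (Fin n) | R ≤ ‖y‖}, (u₀ y : EReal))
      atTop (𝓝 L) ∧
    ∀ x, (u₀ x : EReal) < L

/-- `μ(A) = ∫_A Θ dx`, a finite number when `Θ` is integrable. -/
def mass {n : ℕ} (Θ : EuclideanSpace ℝ (Fin n) → ℝ) (A : Set (EuclideanSpace ℝ (Fin n))) : ℝ≥0 :=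
  (volume.withDensity (fun x => ENNReal.ofReal (Θ x)) A).toNNReal

/-- The signed distance `dist(x, A) - dist(x, ℝⁿ \ A)`, with values in `[-∞, ∞]` because the
distance to the empty set is `+∞`. -/
def signedDistTo {n : ℕ} (A : Set (EuclideanSpace ℝ (Fin n))) (x : EuclideanSpace ℝ (Fin n)) :
    EReal :=
  (Metric.infEDist x A : EReal) - (Metric.infEDist x Aᶜ : EReal)

/-- The open parallel set `D_h(s)` of `D_h(0) = {u₀ < h}`. -/
def parallelD {n : ℕ} (u₀ : EuclideanSpace ℝ (Fin n) → ℝ) (h s : ℝ) :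
    Set (EuclideanSpace ℝ (Fin n)) :=
  {x | signedDistTo {y | u₀ y < h} x < (s : EReal)}

/-- The closed parallel set `E_h(s)` of `E_h(0) = {u₀ ≤ h}`. -/
def parallelE {n : ℕ} (u₀ : EuclideanSpace ℝ (Fin n) → ℝ) (h s : ℝ) :
    Set (EuclideanSpace ℝ (Fin n)) :=
  {x | signedDistTo {y | u₀ y ≤ h} x ≤ (s : EReal)}

/-- The level `h` is critical: `f(h, μ{u₀ < h}) ≤ 0 ≤ f(h, μ{u₀ ≤ h})`. -/
def IsCriticalLevel {n : ℕ} (f : ℝ → ℝ≥0 → ℝ) (Θ u₀ : EuclideanSpace ℝ (Fin n) → ℝ) (h : ℝ) :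
    Prop :=
  f h (mass Θ {x | u₀ x < h}) ≤ 0 ∧ 0 ≤ f h (mass Θ {x | u₀ x ≤ h})

/-- `δ` is a Lipschitz solution on `[0, ∞)` of
`f(h, μ(int W(δ(t)))) ≤ δ'(t) ≤ f(h, μ(cl W(δ(t))))` for a.e. `t ≥ 0`, with `δ(0) = 0`,
for a family of sets `s ↦ W(s)`. Only the values of `δ` on `[0, ∞)` matter. -/
structure IsEvolution {n : ℕ} (f : ℝ → ℝ≥0 → ℝ) (Θ : EuclideanSpace ℝ (Fin n) → ℝ) (h : ℝ)
    (W : ℝ → Set (EuclideanSpace ℝ (Fin n))) (δ : ℝ → ℝ) : Prop where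
  lipschitz : ∃ K : ℝ≥0, LipschitzOnWith K δ (Ici 0)
  initial : δ 0 = 0
  deriv_mem : ∀ᵐ t : ℝ, 0 < t → ∃ v : ℝ, HasDerivAt δ v t ∧
    f h (mass Θ (interior (W (δ t)))) ≤ v ∧ v ≤ f h (mass Θ (closure (W (δ t))))

/-- `δ` is the minimal solution. -/
def IsMinimalEvolution {n : ℕ} (f : ℝ → ℝ≥0 → ℝ) (Θ : EuclideanSpace ℝ (Fin n) → ℝ) (h : ℝ)
    (W : ℝ → Set (EuclideanSpace ℝ (Fin n))) (δ : ℝ → ℝ) : Prop :=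
  IsEvolution f Θ h W δ ∧ ∀ η : ℝ → ℝ, IsEvolution f Θ h W η → ∀ t : ℝ, 0 ≤ t → δ t ≤ η t

/-- `δ` is the maximal solution. -/
def IsMaximalEvolution {n : ℕ} (f : ℝ → ℝ≥0 → ℝ) (Θ : EuclideanSpace ℝ (Fin n) → ℝ) (h : ℝ)
    (W : ℝ → Set (EuclideanSpace ℝ (Fin n))) (δ : ℝ → ℝ) : Prop :=
  IsEvolution f Θ h W δ ∧ ∀ η : ℝ → ℝ, IsEvolution f Θ h W η → ∀ t : ℝ, 0 ≤ t → η t ≤ δ t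

/-- The space-time domain `ℝⁿ × (0, ∞)`. -/
def spaceTime (n : ℕ) : Set (EuclideanSpace ℝ (Fin n) × ℝ) := univ ×ˢ Ioi (0 : ℝ)

/-- `u` is locally bounded in `ℝⁿ × (0, ∞)`. -/
def IsLocallyBounded {n : ℕ} (u : EuclideanSpace ℝ (Fin n) → ℝ → ℝ) : Prop :=
  ∀ p ∈ spaceTime n, ∃ M : ℝ, ∀ᶠ q in 𝓝 p, |u q.1 q.2| ≤ M

/-- Viscosity subsolutions of `u_t + |∇u| f(u, μ{u(·,t) < u(x,t)}) = 0` in `ℝⁿ × (0, ∞)`. -/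
structure IsViscositySubsolution {n : ℕ} (f : ℝ → ℝ≥0 → ℝ) (Θ : EuclideanSpace ℝ (Fin n) → ℝ)
    (u : EuclideanSpace ℝ (Fin n) → ℝ → ℝ) : Prop where
  locallyBounded : IsLocallyBounded u
  usc : UpperSemicontinuousOn (Function.uncurry u) (spaceTime n)
  test : ∀ φ : EuclideanSpace ℝ (Fin n) × ℝ → ℝ, ContDiffOn ℝ 1 φ (spaceTime n) →
    ∀ (x₀ : EuclideanSpace ℝ (Fin n)) (t₀ : ℝ), 0 < t₀ →
      IsLocalMax (fun p : EuclideanSpace ℝ (Fin n) × ℝ => u p.1 p.2 - φ p) (x₀, t₀) →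
      deriv (fun t => φ (x₀, t)) t₀ + ‖gradient (fun x => φ (x, t₀)) x₀‖ *
        f (u x₀ t₀) (mass Θ {y | u y t₀ < u x₀ t₀}) ≤ 0

/-- Viscosity supersolutions of the same equation; here the nonlocal term is evaluated at
`{u(·,t) ≤ u(x,t)}`. -/
structure IsViscositySupersolution {n : ℕ} (f : ℝ → ℝ≥0 → ℝ) (Θ : EuclideanSpace ℝ (Fin n) → ℝ)
    (u : EuclideanSpace ℝ (Fin n) → ℝ → ℝ) : Prop where
  locallyBounded : IsLocallyBounded u
  lsc : LowerSemicontinuousOn (Function.uncurry u) (spaceTime n)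
  test : ∀ φ : EuclideanSpace ℝ (Fin n) × ℝ → ℝ, ContDiffOn ℝ 1 φ (spaceTime n) →
    ∀ (x₀ : EuclideanSpace ℝ (Fin n)) (t₀ : ℝ), 0 < t₀ →
      IsLocalMin (fun p : EuclideanSpace ℝ (Fin n) × ℝ => u p.1 p.2 - φ p) (x₀, t₀) →
      0 ≤ deriv (fun t => φ (x₀, t)) t₀ + ‖gradient (fun x => φ (x, t₀)) x₀‖ *
        f (u x₀ t₀) (mass Θ {y | u y t₀ ≤ u x₀ t₀})

/-- `u` is a continuous viscosity solution of the Cauchy problem with initial value `u₀`, in the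
class of functions with at most linear growth in `x`, locally uniformly in time. Only the values of
`u` at times `t ≥ 0` matter. -/
structure IsSolution {n : ℕ} (f : ℝ → ℝ≥0 → ℝ) (Θ u₀ : EuclideanSpace ℝ (Fin n) → ℝ)
    (u : EuclideanSpace ℝ (Fin n) → ℝ → ℝ) : Prop where
  continuousOn : ContinuousOn (Function.uncurry u) (univ ×ˢ Ici (0 : ℝ))
  subsolution : IsViscositySubsolution f Θ u
  supersolution : IsViscositySupersolution f Θ u
  initial : ∀ x, u x 0 = u₀ x
  growth : ∀ T : ℝ, 0 < T → ∃ M : ℝ, 0 < M ∧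
    ∀ (x : EuclideanSpace ℝ (Fin n)) (t : ℝ), 0 ≤ t → t ≤ T → |u x t| ≤ M * (‖x‖ + 1)

/-- `limsup_{s → 0+} f(h, μ(D_h(-s))) / s^α ≤ -C` for some `0 < α < 1` and `C > 0`. -/
def FastDecayD {n : ℕ} (f : ℝ → ℝ≥0 → ℝ) (Θ u₀ : EuclideanSpace ℝ (Fin n) → ℝ) (h : ℝ) : Prop :=
  ∃ α C : ℝ, 0 < α ∧ α < 1 ∧ 0 < C ∧
    limsup (fun s : ℝ => ((f h (mass Θ (parallelD u₀ h (-s))) / s ^ α : ℝ) : EReal)) (𝓝[>] 0)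
      ≤ ((-C : ℝ) : EReal)

/-- `liminf_{s → 0+} f(h, μ(E_h(s))) / s^α ≥ C` for some `0 < α < 1` and `C > 0`. -/
def FastGrowthE {n : ℕ} (f : ℝ → ℝ≥0 → ℝ) (Θ u₀ : EuclideanSpace ℝ (Fin n) → ℝ) (h : ℝ) : Prop :=
  ∃ α C : ℝ, 0 < α ∧ α < 1 ∧ 0 < C ∧
    ((C : ℝ) : EReal) ≤
      liminf (fun s : ℝ => ((f h (mass Θ (parallelE u₀ h s)) / s ^ α : ℝ) : EReal)) (𝓝[>] 0)

end NonlocalHJ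

end

/-! Extremal evolutions. The speeds `s ↦ f(h, μ(int D_h(s)))` and `s ↦ f(h, μ(cl E_h(s)))` are
bounded and monotone but may jump, so existence comes from order rather than continuity: the
integral operator of the equation is monotone, and its greatest fixed point solves the equation and
dominates every subsolution (`exists_maximal_solution`). The reflection `δ ↦ -δ` turns the minimal
problem for `D` into a maximal one. Criticality of `h` yields the weak signs. Under (1) or (2) the
speed is not Lipschitz at 0, and the subsolution `κ t ^ β`, `β = 1 / (1 - α)`, pushes the extremal
solution off zero.

Level sets. The argument works directly with viscosity tests and does not pass through `δ_D`, `δ_E`.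
Let `ℓ < h`. As long as `{u(·,t) < ℓ}` has distance at least `r` from `{u₀ ≥ h}`, monotonicity of
`f` in both variables bounds the speed on it by `f(h, μ(D_h(-r/2))) ≤ 0` (`rate_bound_D`). A radial
barrier (`front_propagation`) converts this bound into motion: the distance cannot shrink, and under
(1) it outgrows `κ t ^ β` with `κ` independent of `ℓ` (`separation_propagation`). Letting `ℓ ↑ h`,
the set `{u(·,t) ≥ h}` contains `{u₀ ≥ h}`, and under (1) a neighbourhood of it of uniform width.
Applied to `-u`, the same reasoning treats `{u₀ ≤ h}` and condition (2). Near the boundary of `{u₀ <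
h}`, respectively `{u₀ ≤ h}`, the two inclusions overlap in an open set where `u = h`. -/

namespace NonlocalHJ

/-! ### Maximal solutions of scalar equations with monotone, possibly discontinuous speed -/

/-- A speed bounded by `V`, transported to `[0, ∞]` monotonically. -/
noncomputable def extendedSpeed (G : ℝ → ℝ) (V : ℝ) (r : ℝ≥0∞) : ℝ≥0∞ :=
  if r = ⊤ then ENNReal.ofReal V else ENNReal.ofReal (G r.toReal)

theorem extendedSpeed_mono {G : ℝ → ℝ} {V : ℝ} (hG : Monotone G) (hV : ∀ s, G s ≤ V) :
    Monotone (extendedSpeed G V) := by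
  intro a b hab
  unfold extendedSpeed
  split_ifs with ha hb hb
  · exact le_rfl
  · exact absurd (top_le_iff.1 (ha ▸ hab)) hb
  · exact ENNReal.ofReal_le_ofReal (hV _)
  · exact ENNReal.ofReal_le_ofReal (hG (ENNReal.toReal_mono hb hab))

theorem extendedSpeed_le {G : ℝ → ℝ} {V : ℝ} (hV : ∀ s, G s ≤ V) (r : ℝ≥0∞) :
    extendedSpeed G V r ≤ ENNReal.ofReal V := by
  unfold extendedSpeed
  split_ifs
  · exact le_rfl
  · exact ENNReal.ofReal_le_ofReal (hV _)

/-- The monotone Picard operator `ρ ↦ ∫₀ᵗ G(ρ(s)) ds`. -/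
noncomputable def picard (G : ℝ → ℝ) (V : ℝ) (hG : Monotone G) (hV : ∀ s, G s ≤ V) :
    (ℝ → ℝ≥0∞) →o (ℝ → ℝ≥0∞) where
  toFun ρ t := ∫⁻ s in Ioc 0 t, extendedSpeed G V (ρ s)
  monotone' _ _ h _ := lintegral_mono fun s => extendedSpeed_mono hG hV (h s)

theorem integral_deriv_eq_of_lipschitzOnWith {σ : ℝ → ℝ} {K : ℝ≥0}
    (hσ : LipschitzOnWith K σ (Ici 0)) {t : ℝ} (ht : 0 ≤ t) :
    IntervalIntegrable (deriv σ) volume 0 t ∧ ∫ s in (0 : ℝ)..t, deriv σ s = σ t - σ 0 := by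
  have hac : AbsolutelyContinuousOnInterval σ 0 t := by
    refine (hσ.mono ?_).absolutelyContinuousOnInterval
    rw [uIcc_of_le ht]
    exact fun s hs => hs.1
  exact ⟨hac.intervalIntegrable_deriv, hac.integral_deriv_eq_sub⟩

/-- The autonomous equation `ρ' = G(ρ)`, `ρ(0) = 0` with a bounded monotone right-hand side that is
nonnegative on `[0, ∞)` has a solution which lies above all subsolutions. -/
theorem exists_maximal_solution (G : ℝ → ℝ) (hG : Monotone G) (h0 : 0 ≤ G 0) (V : ℝ)
    (hV : ∀ s, G s ≤ V) :
    ∃ ρ : ℝ → ℝ, (∃ K : ℝ≥0, LipschitzOnWith K ρ (Ici 0)) ∧ ρ 0 = 0 ∧ (∀ t, 0 ≤ ρ t) ∧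
      (∀ᵐ t : ℝ, 0 < t → HasDerivAt ρ (G (ρ t)) t) ∧
      ∀ σ : ℝ → ℝ, (∃ K : ℝ≥0, LipschitzOnWith K σ (Ici 0)) → σ 0 = 0 →
        (∀ᵐ t : ℝ, 0 < t → ∃ v, HasDerivAt σ v t ∧ v ≤ G (σ t)) → ∀ t, 0 ≤ t → σ t ≤ ρ t := by
  have hV0 : 0 ≤ V := h0.trans (hV 0)
  -- Knaster–Tarski: the greatest fixed point lies above every function that is at most its own
  -- image, and no continuity of `G` is needed.
  set r : ℝ → ℝ≥0∞ := OrderHom.gfp (picard G V hG hV) with hr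
  have hfix : ∀ t, r t = ∫⁻ s in Ioc 0 t, extendedSpeed G V (r s) := fun t =>
    (congrFun (OrderHom.map_gfp (picard G V hG hV)) t).symm
  have hfin : ∀ t, r t ≠ ⊤ := by
    intro t
    rw [hfix]
    refine (lt_of_le_of_lt (lintegral_mono fun s => extendedSpeed_le hV (r s)) ?_).ne
    rw [lintegral_const]
    exact ENNReal.mul_lt_top ENNReal.ofReal_lt_top (by simp)
  have hrmono : Monotone r := by
    intro a b hab
    rw [hfix, hfix b]
    exact lintegral_mono_set (Ioc_subset_Ioc_right hab)
  set ρ : ℝ → ℝ := fun t => (r t).toReal with hρ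
  have hρmono : Monotone ρ := fun a b hab => ENNReal.toReal_mono (hfin b) (hrmono hab)
  have hρ0 : ∀ t, 0 ≤ ρ t := fun t => ENNReal.toReal_nonneg
  have hGρ0 : ∀ t, 0 ≤ G (ρ t) := fun t => h0.trans (hG (hρ0 t))
  have hmono : Monotone fun s => G (ρ s) := hG.comp hρmono
  have hint : ∀ a b, IntervalIntegrable (fun s => G (ρ s)) volume a b := fun a b =>
    (hmono.monotoneOn _).intervalIntegrable
  have hρint : ∀ t, 0 ≤ t → ρ t = ∫ s in (0 : ℝ)..t, G (ρ s) := by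
    intro t ht
    rw [intervalIntegral.integral_of_le ht,
      integral_eq_lintegral_of_nonneg_ae (Eventually.of_forall hGρ0)
        hmono.measurable.aestronglyMeasurable]
    simp only [hρ]
    rw [hfix t]
    congr 1
    refine lintegral_congr fun s => ?_
    rw [extendedSpeed, if_neg (hfin s)]
  refine ⟨ρ, ⟨V.toNNReal, ?_⟩, ?_, hρ0, ?_, ?_⟩
  · refine LipschitzOnWith.of_dist_le_mul fun a ha b hb => ?_
    rw [Real.coe_toNNReal V hV0, dist_eq_norm, dist_eq_norm, hρint a ha, hρint b hb,
      intervalIntegral.integral_interval_sub_left (hint _ _) (hint _ _)]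
    exact intervalIntegral.norm_integral_le_of_norm_le_const fun x _ =>
      (Real.norm_of_nonneg (hGρ0 x)).trans_le (hV _)
  · rw [hρint 0 le_rfl, intervalIntegral.integral_same]
  · have hloc : LocallyIntegrable (fun s => G (ρ s)) volume := hmono.locallyIntegrable
    filter_upwards [LocallyIntegrable.ae_hasDerivAt_integral hloc] with t ht htpos
    refine (ht 0).congr_of_eventuallyEq ?_
    filter_upwards [lt_mem_nhds htpos] with s hs using hρint s hs.le
  · rintro σ ⟨K, hσ⟩ hσ0 hder
    -- The positive part of a subsolution is at most its Picard image: since `G ≥ 0` on `[0, ∞)`,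
    -- both `σ'` and `0` are at most `G(max σ 0)`.
    have hle : (fun t => if 0 ≤ t then ENNReal.ofReal (σ t) else 0) ≤ r := by
      refine OrderHom.le_gfp _ fun t => ?_
      by_cases ht : 0 ≤ t
      · simp only [if_pos ht]
        change ENNReal.ofReal (σ t) ≤ ∫⁻ s in Ioc 0 t,
          extendedSpeed G V (if 0 ≤ s then ENNReal.ofReal (σ s) else 0)
        obtain ⟨hi, he⟩ := integral_deriv_eq_of_lipschitzOnWith hσ ht
        rw [hσ0, sub_zero, intervalIntegral.integral_of_le ht] at he
        have hi' : IntegrableOn (deriv σ) (Ioc 0 t) volume :=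
          (intervalIntegrable_iff_integrableOn_Ioc_of_le ht).1 hi
        have h1 : σ t ≤ ∫ s in Ioc 0 t, max (deriv σ s) 0 := by
          rw [← he]
          exact integral_mono hi' hi'.pos_part fun s => le_max_left _ _
        refine (ENNReal.ofReal_le_ofReal h1).trans ?_
        rw [ofReal_integral_eq_lintegral_ofReal hi'.pos_part
          (Eventually.of_forall fun s => le_max_right _ _)]
        refine lintegral_mono_ae ?_
        filter_upwards [ae_restrict_of_ae hder, ae_restrict_mem measurableSet_Ioc] with s hs hs'
        obtain ⟨v, hv, hvG⟩ := hs hs'.1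
        rw [hv.deriv, if_pos hs'.1.le, extendedSpeed, if_neg ENNReal.ofReal_ne_top,
          ENNReal.toReal_ofReal']
        refine ENNReal.ofReal_le_ofReal (max_le (hvG.trans (hG (le_max_left _ _)))
          (h0.trans (hG (le_max_right _ _))))
      · simp [if_neg ht]
    intro t ht
    have := hle t
    simp only [if_pos ht] at this
    exact (ENNReal.ofReal_le_iff_le_toReal (hfin t)).1 this

/-! ### Radial barriers and propagation of fronts -/

/-- Viscosity supersolutions of `w_t + |∇w| S = 0` for a prescribed speed `S(x, t)`. -/
def IsSupersolutionWithSpeed {n : ℕ} (w S : EuclideanSpace ℝ (Fin n) → ℝ → ℝ) : Prop :=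
  ∀ φ : EuclideanSpace ℝ (Fin n) × ℝ → ℝ, ContDiffOn ℝ 1 φ (spaceTime n) →
    ∀ (x₀ : EuclideanSpace ℝ (Fin n)) (t₀ : ℝ), 0 < t₀ →
      IsLocalMin (fun p : EuclideanSpace ℝ (Fin n) × ℝ => w p.1 p.2 - φ p) (x₀, t₀) →
      0 ≤ deriv (fun t => φ (x₀, t)) t₀ + ‖gradient (fun x => φ (x, t₀)) x₀‖ * S x₀ t₀

/-- A `C¹` function decreasing from `ℓ` to `b`, with the drop in `[a, a + η]`. -/
theorem exists_smooth_drop {ℓ b a η : ℝ} (hb : b ≤ ℓ) (hη : 0 < η) :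
    ∃ ψ : ℝ → ℝ, ContDiff ℝ 1 ψ ∧ (∀ q, ψ q ≤ ℓ) ∧ (∀ q, q ≤ a → ψ q = ℓ) ∧
      (∀ q, a + η ≤ q → ψ q = b) ∧ (∀ q, deriv ψ q ≤ 0) ∧ (∀ q, q < a → deriv ψ q = 0) := by
  have hlow : ∀ q, q ≤ a → ℓ - (ℓ - b) * Real.smoothTransition ((q - a) / η) = ℓ := by
    intro q hq
    rw [Real.smoothTransition.zero_of_nonpos (div_nonpos_of_nonpos_of_nonneg (by linarith) hη.le)]
    ring
  have hhigh : ∀ q, a + η ≤ q → ℓ - (ℓ - b) * Real.smoothTransition ((q - a) / η) = b := by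
    intro q hq
    rw [Real.smoothTransition.one_of_one_le ((one_le_div hη).2 (by linarith))]
    ring
  refine ⟨fun q => ℓ - (ℓ - b) * Real.smoothTransition ((q - a) / η), ?_, ?_, hlow, hhigh,
    ?_, ?_⟩
  · have := Real.smoothTransition.contDiff (n := 1)
    fun_prop
  · intro q
    have := mul_nonneg (sub_nonneg.2 hb) (Real.smoothTransition.nonneg ((q - a) / η))
    linarith
  · intro q
    refine Antitone.deriv_nonpos fun x y hxy => ?_
    have h1 : (x - a) / η ≤ (y - a) / η := by gcongr
    have := mul_le_mul_of_nonneg_left (Real.smoothTransition.monotone h1) (sub_nonneg.2 hb)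
    linarith
  · intro q hq
    have : (fun q => ℓ - (ℓ - b) * Real.smoothTransition ((q - a) / η)) =ᶠ[𝓝 q] fun _ => ℓ := by
      filter_upwards [gt_mem_nhds hq] with x hx using hlow x hx.le
    rw [this.deriv_eq, deriv_const]

/-- At a point where a radial barrier with front velocity `v` touches from below, a speed at most
`v` contradicts the supersolution property. -/
theorem not_isLocalMin_radial_barrier {n : ℕ} {w S : EuclideanSpace ℝ (Fin n) → ℝ → ℝ}
    (hw : IsSupersolutionWithSpeed w S) {ψ : ℝ → ℝ} (hψ : ContDiff ℝ 1 ψ)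
    (hψ' : ∀ q, deriv ψ q ≤ 0) (x₀ : EuclideanSpace ℝ (Fin n)) {R v t₀ e k t₂ : ℝ}
    (he : 0 < e) (hk : 0 < k) {x : EuclideanSpace ℝ (Fin n)} {t : ℝ} (ht : 0 < t)
    (hS : S x t ≤ v)
    (hsign : deriv ψ (‖x - x₀‖ ^ 2 - (R - v * (t - t₀)) ^ 2) ≠ 0 →
      v * (‖x - x₀‖ - (R - v * (t - t₀))) ≤ 0) :
    ¬ IsLocalMin (fun p : EuclideanSpace ℝ (Fin n) × ℝ => w p.1 p.2 -
      (ψ (‖p.1 - x₀‖ ^ 2 - (R - v * (p.2 - t₀)) ^ 2) - e * Real.exp (k * (p.2 - t₂)))) (x, t) := by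
  intro hmin
  have hC : ContDiff ℝ 1 (fun p : EuclideanSpace ℝ (Fin n) × ℝ =>
      ψ (‖p.1 - x₀‖ ^ 2 - (R - v * (p.2 - t₀)) ^ 2) - e * Real.exp (k * (p.2 - t₂))) := by
    have h1 : ContDiff ℝ 1 (fun p : EuclideanSpace ℝ (Fin n) × ℝ => ‖p.1 - x₀‖ ^ 2) :=
      (contDiff_fst.sub contDiff_const).norm_sq ℝ
    fun_prop
  have h := hw _ hC.contDiffOn x t ht hmin
  have hψd := fun q => (hψ.differentiable one_ne_zero q).hasDerivAt
  set q := ‖x - x₀‖ ^ 2 - (R - v * (t - t₀)) ^ 2 with hq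
  have hder : HasDerivAt (fun s => ψ (‖x - x₀‖ ^ 2 - (R - v * (s - t₀)) ^ 2)
      - e * Real.exp (k * (s - t₂)))
      (deriv ψ q * (2 * (R - v * (t - t₀)) * v) - e * (Real.exp (k * (t - t₂)) * k)) t := by
    have h1 : HasDerivAt (fun s => ‖x - x₀‖ ^ 2 - (R - v * (s - t₀)) ^ 2)
        (2 * (R - v * (t - t₀)) * v) t := by
      have h2 : HasDerivAt (fun s => R - v * (s - t₀)) (-v) t := by
        simpa using (((hasDerivAt_id t).sub_const t₀).const_mul v).const_sub R
      have h3 := (h2.pow 2).const_sub (‖x - x₀‖ ^ 2)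
      refine h3.congr_deriv ?_
      push_cast
      ring
    have h4 : HasDerivAt (fun s => k * (s - t₂)) k t := by
      simpa using ((hasDerivAt_id t).sub_const t₂).const_mul k
    exact ((hψd q).comp t h1).sub (h4.exp.const_mul e)
  have hgrad : HasFDerivAt (fun y => ψ (‖y - x₀‖ ^ 2 - (R - v * (t - t₀)) ^ 2)
      - e * Real.exp (k * (t - t₂)))
      (deriv ψ q • (2 • innerSL ℝ (x - x₀))) x := by
    have h1 : HasFDerivAt (fun y => ‖y - x₀‖ ^ 2 - (R - v * (t - t₀)) ^ 2)
        (2 • innerSL ℝ (x - x₀)) x := by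
      have := (((hasFDerivAt_id (𝕜 := ℝ) x).sub_const x₀).norm_sq).sub_const
        ((R - v * (t - t₀)) ^ 2)
      simpa using this
    exact ((hψd q).comp_hasFDerivAt x h1).sub_const _
  have hnorm : ‖gradient (fun y => ψ (‖y - x₀‖ ^ 2 - (R - v * (t - t₀)) ^ 2)
      - e * Real.exp (k * (t - t₂))) x‖ = - deriv ψ q * (2 * ‖x - x₀‖) := by
    rw [gradient, LinearIsometryEquiv.norm_map, hgrad.fderiv, norm_smul, Real.norm_eq_abs,
      abs_of_nonpos (hψ' q), ← Nat.cast_smul_eq_nsmul ℝ, norm_smul, innerSL_apply_norm]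
    simp
  have hexp : 0 < e * (Real.exp (k * (t - t₂)) * k) := by positivity
  simp only at h
  rw [hder.deriv, hnorm] at h
  have hle : - deriv ψ q * (2 * ‖x - x₀‖) * S x t ≤ - deriv ψ q * (2 * ‖x - x₀‖) * v :=
    mul_le_mul_of_nonneg_left hS
      (mul_nonneg (neg_nonneg.2 (hψ' q)) (by positivity))
  -- With `S` replaced by `v`, the drop contributes `-2 ψ' v (|x - x₀| - r(t))` to the equation,
  -- where `r(t)` is the moving radius. By `hsign` this is nonpositive, so the exponential term
  -- makes the total strictly negative.
  have hfin : 0 ≤ deriv ψ q * (v * (‖x - x₀‖ - (R - v * (t - t₀)))) := by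
    by_cases h0 : deriv ψ q = 0
    · simp [h0]
    · exact mul_nonneg_of_nonpos_of_nonpos (hψ' q) (hsign h0)
  nlinarith

/-- Front propagation: if the speed is at most `v` on `{w < ℓ}` during `(t₀, t₁)`, then a ball on
which `w ≥ ℓ` at time `t₀` remains so when its radius changes with velocity `-v`. -/
theorem front_propagation {n : ℕ} {w S : EuclideanSpace ℝ (Fin n) → ℝ → ℝ}
    (hw : IsSupersolutionWithSpeed w S)
    (hc : ContinuousOn (Function.uncurry w) (univ ×ˢ Ici (0 : ℝ)))
    {t₀ t₁ ℓ v R : ℝ} (ht₀ : 0 ≤ t₀) (hv : 0 < R - v * (t₁ - t₀))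
    (hS : ∀ t ∈ Ioo t₀ t₁, ∀ x, w x t < ℓ → S x t ≤ v) (x₀ : EuclideanSpace ℝ (Fin n))
    (hR : 0 < R) (hinit : ∀ x ∈ Metric.ball x₀ R, ℓ ≤ w x t₀) :
    ∀ t ∈ Ico t₀ t₁, ∀ x ∈ Metric.ball x₀ (R - v * (t - t₀)), ℓ ≤ w x t := by
  intro t₂ ht₂ x₂ hx₂
  by_contra! hlt
  have ht01 : t₀ < t₁ := ht₂.1.trans_lt ht₂.2
  -- the shrunken radius and the width of the drop
  rw [Metric.mem_ball, dist_eq_norm] at hx₂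
  obtain ⟨d, hd0, hdR, hd1, hd2⟩ : ∃ d, 0 < d ∧ d < R ∧ d < R - v * (t₁ - t₀) ∧
      ‖x₂ - x₀‖ < R - d - v * (t₂ - t₀) := by
    obtain ⟨d, h1, h2⟩ := exists_between (show 0 < min (min R (R - v * (t₁ - t₀)))
      (R - v * (t₂ - t₀) - ‖x₂ - x₀‖) from lt_min (lt_min hR hv) (by linarith))
    simp only [lt_min_iff] at h2
    exact ⟨d, h1, h2.1.1, h2.1.2, by linarith [h2.2]⟩
  set R' := R - d with hR'
  have hR'0 : 0 < R' := by linarith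
  have hrad : ∀ t ∈ Icc t₀ t₁, 0 < R' - v * (t - t₀) := by
    intro t ht
    rcases le_total 0 v with h | h
    · have := mul_le_mul_of_nonneg_left ht.2 h
      nlinarith
    · have := mul_nonpos_of_nonpos_of_nonneg h (sub_nonneg.2 ht.1)
      linarith
  have hrad' : ∀ t ∈ Icc t₀ t₁, R' - v * (t - t₀) ≤ R + |v| * (t₁ - t₀) := by
    intro t ht
    have h1 := mul_le_mul_of_nonneg_right (neg_abs_le v) (sub_nonneg.2 ht.1)
    have h2 := mul_le_mul_of_nonneg_left (sub_le_sub_right ht.2 t₀) (abs_nonneg v)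
    linarith
  -- The third condition keeps the drop inside the initial ball at time `t₀`; the fourth places
  -- `(x₂, t₂)` before the drop.
  obtain ⟨η, hη0, hη1, hηR, hηx⟩ : ∃ η, 0 < η ∧ η ≤ 1 ∧ R' ^ 2 + η ≤ R ^ 2 ∧
      ‖x₂ - x₀‖ ^ 2 + η ≤ (R' - v * (t₂ - t₀)) ^ 2 := by
    have h1 : 0 < R ^ 2 - R' ^ 2 := by nlinarith
    have h2 : 0 < (R' - v * (t₂ - t₀)) ^ 2 - ‖x₂ - x₀‖ ^ 2 := by
      nlinarith [norm_nonneg (x₂ - x₀)]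
    refine ⟨min 1 (min (R ^ 2 - R' ^ 2) ((R' - v * (t₂ - t₀)) ^ 2 - ‖x₂ - x₀‖ ^ 2)),
      lt_min one_pos (lt_min h1 h2), min_le_left _ _, ?_, ?_⟩
    · linarith [(min_le_right 1 (min (R ^ 2 - R' ^ 2)
        ((R' - v * (t₂ - t₀)) ^ 2 - ‖x₂ - x₀‖ ^ 2))).trans (min_le_left _ _)]
    · linarith [(min_le_right 1 (min (R ^ 2 - R' ^ 2)
        ((R' - v * (t₂ - t₀)) ^ 2 - ‖x₂ - x₀‖ ^ 2))).trans (min_le_right _ _)]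
  -- the compact cylinder
  set B := R + |v| * (t₁ - t₀) + 1 with hB
  set K : Set (EuclideanSpace ℝ (Fin n) × ℝ) := Metric.closedBall x₀ B ×ˢ Icc t₀ t₁ with hK
  have hKc : IsCompact K := (isCompact_closedBall x₀ B).prod isCompact_Icc
  have hKsub : K ⊆ univ ×ˢ Ici (0 : ℝ) := fun p hp => ⟨mem_univ _, ht₀.trans hp.2.1⟩
  have hcK : ContinuousOn (Function.uncurry w) K := hc.mono hKsub
  obtain ⟨M, hM⟩ : ∃ M : ℝ, ∀ p ∈ K, M ≤ w p.1 p.2 := by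
    obtain ⟨M, hM⟩ := hKc.bddBelow_image hcK
    exact ⟨M, fun p hp => hM ⟨p, hp, rfl⟩⟩
  set b := min ℓ M with hb
  -- The sign condition on the barrier decides where the drop sits: outside the moving sphere if `v
  -- ≤ 0`, inside it if `v ≥ 0`.
  obtain ⟨a, haη, ha⟩ : ∃ a : ℝ, (a + η ≤ η) ∧ ((v ≤ 0 ∧ a = 0) ∨ (0 ≤ v ∧ a = -η)) := by
    rcases le_total v 0 with h | h
    · exact ⟨0, by simp, Or.inl ⟨h, rfl⟩⟩
    · exact ⟨-η, by linarith, Or.inr ⟨h, rfl⟩⟩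
  have ha' : -η ≤ a := by rcases ha with ⟨-, h⟩ | ⟨-, h⟩ <;> linarith
  obtain ⟨ψ, hψC, hψℓ, hψtop, hψbot, hψ', hψ'0⟩ :=
    exists_smooth_drop (a := a) (min_le_left ℓ M) hη0
  -- At `t₂` the penalty is `e`, half of the gap, so the barrier still exceeds `w` there. At `t₁`
  -- the choice of `k` makes it at least `|ℓ - M| + 1`, which brings the barrier below `M`.
  set e := (ℓ - w x₂ t₂) / 2 with he
  have he0 : 0 < e := by linarith
  set k := (|ℓ - M| + 1) / (e * (t₁ - t₂)) with hk
  have ht12 : 0 < t₁ - t₂ := sub_pos.2 ht₂.2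
  have hk0 : 0 < k := by positivity
  set φ : EuclideanSpace ℝ (Fin n) × ℝ → ℝ := fun p =>
    ψ (‖p.1 - x₀‖ ^ 2 - (R' - v * (p.2 - t₀)) ^ 2) - e * Real.exp (k * (p.2 - t₂)) with hφ
  have hφc : Continuous φ := by
    have := hψC.continuous
    fun_prop
  have hx₂B : ‖x₂ - x₀‖ ≤ B := by
    linarith [hrad' t₂ (Ico_subset_Icc_self ht₂)]
  have hp₂ : (x₂, t₂) ∈ K :=
    ⟨by simpa [Metric.mem_closedBall, dist_eq_norm] using hx₂B, Ico_subset_Icc_self ht₂⟩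
  obtain ⟨⟨x, t⟩, hpK, hpmin⟩ := hKc.exists_isMinOn ⟨_, hp₂⟩ (hcK.sub hφc.continuousOn)
  have hexp : ∀ s, 0 < e * Real.exp (k * (s - t₂)) := fun s => by positivity
  -- A negative minimum forces `w < φ < ℓ` at the touching point, so the speed bound applies there.
  -- It also keeps the point off the bottom of the drop, which excludes the initial time and the
  -- lateral boundary.
  have hneg : w x t - φ (x, t) < 0 := by
    refine (hpmin hp₂).trans_lt ?_
    change w x₂ t₂ - φ (x₂, t₂) < 0
    have : φ (x₂, t₂) = ℓ - e := by
      simp only [hφ, sub_self, mul_zero, Real.exp_zero, mul_one]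
      rw [hψtop _ (by linarith)]
    rw [this]
    linarith
  have hφℓ : φ (x, t) < ℓ := by
    have h1 := hψℓ (‖x - x₀‖ ^ 2 - (R' - v * (t - t₀)) ^ 2)
    have h2 := hexp t
    simp only [hφ]
    linarith
  have hMx : M ≤ w x t := hM _ hpK
  have hnotbot : ‖x - x₀‖ ^ 2 - (R' - v * (t - t₀)) ^ 2 < a + η := by
    by_contra! h
    have h1 : φ (x, t) < M := by
      simp only [hφ]
      rw [hψbot _ h]
      linarith [hexp t, min_le_right ℓ M]
    linarith
  have ht0 : t ≠ t₀ := by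
    rintro rfl
    have h1 : ‖x - x₀‖ ^ 2 < R ^ 2 := by
      simp only [sub_self, mul_zero, sub_zero] at hnotbot
      linarith
    have h2 := hinit x (by
      rw [Metric.mem_ball, dist_eq_norm]
      exact lt_of_pow_lt_pow_left₀ 2 hR.le h1)
    linarith
  have ht1 : t ≠ t₁ := by
    rintro rfl
    have h1 : e * Real.exp (k * (t - t₂)) ≥ |ℓ - M| + 1 := by
      have h2 := Real.add_one_le_exp (k * (t - t₂))
      have h3 : e * (k * (t - t₂)) = |ℓ - M| + 1 := by
        rw [hk]
        field_simp
      nlinarith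
    have h4 := hψℓ (‖x - x₀‖ ^ 2 - (R' - v * (t - t₀)) ^ 2)
    have h5 : φ (x, t) ≤ ℓ - (|ℓ - M| + 1) := by
      simp only [hφ]
      linarith
    linarith [le_abs_self (ℓ - M)]
  have htI : t ∈ Ioo t₀ t₁ :=
    ⟨lt_of_le_of_ne hpK.2.1 (Ne.symm ht0), lt_of_le_of_ne hpK.2.2 ht1⟩
  have hxB : ‖x - x₀‖ < B := by
    by_contra! h
    have h1 := hrad t hpK.2
    have h2 := hrad' t hpK.2
    nlinarith
  have hloc : IsLocalMin (fun p : EuclideanSpace ℝ (Fin n) × ℝ => w p.1 p.2 - φ p) (x, t) := by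
    refine hpmin.isLocalMin (prod_mem_nhds ?_ (Icc_mem_nhds htI.1 htI.2))
    refine Metric.closedBall_mem_nhds_of_mem ?_
    rwa [Metric.mem_ball, dist_eq_norm]
  refine not_isLocalMin_radial_barrier hw hψC hψ' x₀ he0 hk0 (ht₀.trans_lt htI.1)
    (hS t htI x (by linarith)) ?_ hloc
  intro hne
  have hr := hrad t hpK.2
  have h1 : a ≤ ‖x - x₀‖ ^ 2 - (R' - v * (t - t₀)) ^ 2 := by
    by_contra! h
    exact hne (hψ'0 _ h)
  rcases ha with ⟨hv0, rfl⟩ | ⟨hv0, rfl⟩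
  · refine mul_nonpos_of_nonpos_of_nonneg hv0 (sub_nonneg.2 ?_)
    exact le_of_sq_le_sq (by linarith) (norm_nonneg _)
  · refine mul_nonpos_of_nonneg_of_nonpos hv0 (sub_nonpos.2 ?_)
    exact le_of_sq_le_sq (by linarith) hr.le

/-! ### Root growth and power subsolutions -/

/-- `Φ(s) ≥ C s ^ α` for small `s > 0`, with some `0 < α < 1` and `C > 0`. -/
def HasRootGrowth (Φ : ℝ → ℝ) : Prop :=
  ∃ α C s₁ : ℝ, 0 < α ∧ α < 1 ∧ 0 < C ∧ 0 < s₁ ∧ ∀ s, 0 < s → s < s₁ → C * s ^ α ≤ Φ s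

/-- A power `κ t ^ β` is a strict subsolution of `g' = C (g / 4) ^ α`. -/
theorem exists_power_subsolution {α C s₁ T : ℝ} (hα₀ : 0 < α) (hα₁ : α < 1) (hC : 0 < C)
    (hs₁ : 0 < s₁) :
    ∃ κ β : ℝ, 0 < κ ∧ 1 < β ∧ ∀ t, 0 < t → t ≤ T →
      κ * t ^ β < s₁ ∧ κ * (β * t ^ (β - 1)) < C * (κ * t ^ β / 4) ^ α := by
  -- This exponent satisfies `β α = β - 1`, so both sides scale like `t ^ (β - 1)` and a small `κ`
  -- gives the inequality.
  set β := (1 - α)⁻¹ with hβ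
  have h1α : 0 < 1 - α := by linarith
  have hβ1 : 1 < β := (one_lt_inv₀ h1α).2 (by linarith)
  have hβα : β * α = β - 1 := by
    rw [hβ]
    field_simp
    ring
  have h1 : ∀ᶠ κ : ℝ in 𝓝[>] 0, κ * T ^ β < s₁ := by
    have : Tendsto (fun κ : ℝ => κ * T ^ β) (𝓝 0) (𝓝 (0 * T ^ β)) :=
      tendsto_id.mul_const _
    rw [zero_mul] at this
    exact (this.mono_left nhdsWithin_le_nhds).eventually (gt_mem_nhds hs₁)
  have h2 : ∀ᶠ κ : ℝ in 𝓝[>] 0, κ ^ (1 - α) * β < C * (1 / 4) ^ α := by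
    have : Tendsto (fun κ : ℝ => κ ^ (1 - α) * β) (𝓝 0) (𝓝 (0 ^ (1 - α) * β)) :=
      (Real.continuousAt_rpow_const 0 (1 - α) (Or.inr h1α.le)).tendsto.mul_const _
    rw [Real.zero_rpow h1α.ne', zero_mul] at this
    exact (this.mono_left nhdsWithin_le_nhds).eventually (gt_mem_nhds (by positivity))
  obtain ⟨κ, ⟨hκ1, hκ2⟩, hκ0 : 0 < κ⟩ := ((h1.and h2).and self_mem_nhdsWithin).exists
  refine ⟨κ, β, hκ0, hβ1, fun t ht htT => ⟨?_, ?_⟩⟩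
  · refine lt_of_le_of_lt ?_ hκ1
    have := Real.rpow_le_rpow ht.le htT (by linarith : 0 ≤ β)
    gcongr
  · have h3 : (κ * t ^ β / 4) ^ α = κ ^ α * t ^ (β - 1) * (1 / 4) ^ α := by
      rw [div_eq_mul_one_div, Real.mul_rpow (by positivity) (by positivity),
        Real.mul_rpow hκ0.le (by positivity), ← Real.rpow_mul ht.le, hβα]
    have h4 : κ = κ ^ α * κ ^ (1 - α) := by
      rw [← Real.rpow_add hκ0]
      simp
    have h5 : 0 < κ ^ α * t ^ (β - 1) := by positivity
    rw [h3]
    calc κ * (β * t ^ (β - 1)) = (κ ^ α * κ ^ (1 - α)) * (β * t ^ (β - 1)) := by rw [← h4]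
      _ = κ ^ α * t ^ (β - 1) * (κ ^ (1 - α) * β) := by ring
      _ < κ ^ α * t ^ (β - 1) * (C * (1 / 4) ^ α) := by gcongr
      _ = C * (κ ^ α * t ^ (β - 1) * (1 / 4) ^ α) := by ring

/-- A function above all subsolutions of `σ' = G(σ)`, `σ(0) = 0`, is positive at positive times
when `G` grows like a root at `0`. -/
theorem pos_of_dominates_subsolutions {G ρ : ℝ → ℝ} (h0 : 0 ≤ G 0) (hG : Monotone G)
    (hmax : ∀ σ : ℝ → ℝ, (∃ K : ℝ≥0, LipschitzOnWith K σ (Ici 0)) → σ 0 = 0 →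
      (∀ᵐ t : ℝ, 0 < t → ∃ v, HasDerivAt σ v t ∧ v ≤ G (σ t)) → ∀ t, 0 ≤ t → σ t ≤ ρ t)
    (hgrow : HasRootGrowth G) {t : ℝ} (ht : 0 < t) : 0 < ρ t := by
  obtain ⟨α, C, s₁, hα₀, hα₁, hC, hs₁, hG₁⟩ := hgrow
  obtain ⟨κ, β, hκ, hβ, hp⟩ := exists_power_subsolution (T := t) hα₀ hα₁ hC hs₁
  have hder : ∀ s, HasDerivAt (fun s : ℝ => κ * s ^ β) (κ * (β * s ^ (β - 1))) s := fun s =>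
    (Real.hasDerivAt_rpow_const (Or.inr hβ.le)).const_mul κ
  have hpos : 0 < κ * t ^ β := by positivity
  -- The comparison function is `s ↦ κ (min s t) ^ β`: frozen after time `t`, it is Lipschitz and a
  -- subsolution on all of `[0, ∞)`.
  suffices h : κ * (min t t) ^ β ≤ ρ t by
    rw [min_self] at h
    exact hpos.trans_le h
  refine hmax (fun s => κ * (min s t) ^ β) ?_ ?_ ?_ t ht.le
  · have hLip : LipschitzOnWith (κ * (β * t ^ (β - 1))).toNNReal (fun s : ℝ => κ * s ^ β)
        (Icc 0 t) := by
      refine Convex.lipschitzOnWith_of_nnnorm_hasDerivWithin_le (convex_Icc 0 t)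
        (fun s _ => (hder s).hasDerivWithinAt) fun s hs => ?_
      rw [← NNReal.coe_le_coe, coe_nnnorm, Real.coe_toNNReal _ (by positivity), Real.norm_eq_abs,
        abs_of_nonneg (by have := hs.1; positivity)]
      have := Real.rpow_le_rpow hs.1 hs.2 (by linarith : 0 ≤ β - 1)
      gcongr
    have hmin : LipschitzOnWith 1 (fun s : ℝ => min s t) (Ici 0) :=
      (LipschitzWith.id.min_const t).lipschitzOnWith
    exact ⟨_, hLip.comp hmin fun s hs => ⟨le_min hs ht.le, min_le_right _ _⟩⟩
  · simp [min_eq_left ht.le, Real.zero_rpow (by linarith : β ≠ 0)]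
  · have hne : ∀ᵐ s : ℝ, s ≠ t := by
      simp [ae_iff]
    filter_upwards [hne] with s hs hs0
    rcases lt_or_gt_of_ne hs with hlt | hgt
    · refine ⟨κ * (β * s ^ (β - 1)), (hder s).congr_of_eventuallyEq ?_, ?_⟩
      · filter_upwards [gt_mem_nhds hlt] with x hx
        rw [min_eq_left (le_of_lt hx)]
      · obtain ⟨h1, h2⟩ := hp s hs0 hlt.le
        have h3 : 0 < κ * s ^ β := by positivity
        rw [min_eq_left hlt.le]
        refine h2.le.trans (le_trans ?_ (hG₁ _ h3 h1))
        gcongr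
        linarith
    · refine ⟨0, (hasDerivAt_const s (κ * t ^ β)).congr_of_eventuallyEq ?_, ?_⟩
      · filter_upwards [lt_mem_nhds hgt] with x hx
        rw [min_eq_right (le_of_lt hx)]
      · rw [min_eq_right (le_of_lt hgt)]
        exact h0.trans (hG hpos.le)

/-! ### Growth of the distance between a sublevel set and a fixed set -/

section Separation

variable {n : ℕ} {w S : EuclideanSpace ℝ (Fin n) → ℝ → ℝ}

/-- If the distance of `{w < ℓ}` to `Z` can only grow at rate at least `φ(r / 2)` when it is `r`,
then it stays above any `g` whose growth is controlled by this rate. -/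
theorem separation_propagation (hw : IsSupersolutionWithSpeed w S)
    (hc : ContinuousOn (Function.uncurry w) (univ ×ˢ Ici (0 : ℝ)))
    {Z : Set (EuclideanSpace ℝ (Fin n))} {ℓ V T : ℝ} (hV : 0 < V) (hSV : ∀ x t, S x t ≤ V)
    {φ : ℝ → ℝ} (hφ : ∀ r, 0 < r → 0 ≤ φ r)
    (hS : ∀ t, 0 < t → ∀ r, 0 < r → (∀ z ∈ Z, ∀ x ∈ Metric.ball z r, ℓ ≤ w x t) →
      ∀ x, w x t < ℓ → S x t ≤ -φ r)
    {g : ℝ → ℝ} (hgc : ContinuousOn g (Icc 0 T)) (hg0 : ∀ t ∈ Icc 0 T, 0 < g t)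
    (hg : ∀ t ∈ Ico 0 T, ∀ᶠ s in 𝓝[>] t, g s ≤ g t + φ (g t / 2) * (s - t))
    (h0 : ∀ z ∈ Z, ∀ x ∈ Metric.ball z (g 0), ℓ ≤ w x 0) (hT : 0 ≤ T) :
    ∀ z ∈ Z, ∀ x ∈ Metric.ball z (g T), ℓ ≤ w x T := by
  set P : Set ℝ := {t | ∀ z ∈ Z, ∀ x ∈ Metric.ball z (g t), ℓ ≤ w x t} with hP
  suffices h : Icc 0 T ⊆ P from h (right_mem_Icc.2 hT)
  refine IsClosed.Icc_subset_of_forall_exists_gt ?_ h0 ?_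
  · have hEq : P ∩ Icc 0 T = Icc 0 T ∩ ⋂ z ∈ Z, ⋂ x : EuclideanSpace ℝ (Fin n),
        ((Icc 0 T ∩ {t | g t ≤ dist x z}) ∪ (Icc 0 T ∩ {t | ℓ ≤ w x t})) := by
      ext t
      simp only [hP, mem_inter_iff, mem_ofPred_eq, mem_iInter, mem_union, Metric.mem_ball]
      constructor
      · rintro ⟨h, ht⟩
        refine ⟨ht, fun z hz x => ?_⟩
        rcases le_or_gt (g t) (dist x z) with h' | h'
        · exact Or.inl ⟨ht, h'⟩
        · exact Or.inr ⟨ht, h z hz x h'⟩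
      · rintro ⟨ht, h⟩
        refine ⟨fun z hz x hx => ?_, ht⟩
        rcases h z hz x with h' | h'
        · exact absurd h'.2 (not_le.2 hx)
        · exact h'.2
    rw [hEq]
    refine isClosed_Icc.inter (isClosed_biInter fun z _ => isClosed_iInter fun x => ?_)
    refine IsClosed.union ?_ ?_
    · exact hgc.preimage_isClosed_of_isClosed isClosed_Icc isClosed_Iic
    · have : ContinuousOn (fun t => w x t) (Icc 0 T) := by
        refine hc.comp (f := fun t : ℝ => (x, t)) (by fun_prop) fun t ht => ?_
        exact ⟨mem_univ _, ht.1⟩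
      exact this.preimage_isClosed_of_isClosed isClosed_Icc isClosed_Ici
  · rintro t ⟨htP, htI⟩ y hy
    have hgt := hg0 t (Ico_subset_Icc_self htI)
    -- At speed at most `V` the separation needs this long to halve. Until then the rate `φ (g t /
    -- 2)` is available, and a second use of `front_propagation` with this better speed gives the
    -- growth.
    set t₁ := t + g t / (2 * V) with ht₁
    have htt₁ : t < t₁ := by
      have : 0 < g t / (2 * V) := by positivity
      linarith
    have hVt : V * (t₁ - t) = g t / 2 := by
      rw [ht₁]
      field_simp
      ring
    have hspeed : ∀ s ∈ Ioo t t₁, ∀ x, w x s < ℓ → S x s ≤ -φ (g t / 2) := by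
      intro s hs
      refine hS s (htI.1.trans_lt hs.1) _ (by positivity) fun z hz x hx => ?_
      refine front_propagation (t₀ := t) (t₁ := t₁) (v := V) (R := g t) hw hc htI.1
        (by linarith) (fun s _ x _ => hSV x s) z hgt (htP z hz) s (Ioo_subset_Ico_self hs) x ?_
      refine Metric.ball_subset_ball ?_ hx
      have := mul_le_mul_of_nonneg_left (sub_le_sub_right hs.2.le t) hV.le
      linarith
    have hφt := hφ (g t / 2) (by positivity)
    have hevent : ∀ᶠ s in 𝓝[>] t, s ∈ P := by
      filter_upwards [hg t htI, Ioo_mem_nhdsGT htt₁] with s hs hsI z hz x hx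
      refine front_propagation (t₀ := t) (t₁ := t₁) (v := -φ (g t / 2)) (R := g t) hw hc htI.1
        (by nlinarith) hspeed z hgt (htP z hz) s (Ioo_subset_Ico_self hsI) x ?_
      refine Metric.ball_subset_ball ?_ hx
      linarith
    obtain ⟨s, hsP, hs⟩ := (hevent.and (Ioc_mem_nhdsGT hy)).exists
    exact ⟨s, hsP, hs⟩

variable {Φ : ℝ → ℝ} {ℓ₀ V : ℝ}

/-- Uniform continuity separates the two sets only for `ℓ` strictly below `ℓ₀`; hence the later
estimates are made for each `ℓ < ℓ₀` and then passed to the limit. -/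
theorem exists_initial_separation (hu : UniformContinuous fun x => w x 0) {ℓ : ℝ} (hℓ : ℓ < ℓ₀) :
    ∃ d > 0, ∀ z ∈ {z | ℓ₀ ≤ w z 0}, ∀ x ∈ Metric.ball z d, ℓ ≤ w x 0 := by
  obtain ⟨d, hd, h⟩ := Metric.uniformContinuous_iff.1 hu (ℓ₀ - ℓ) (sub_pos.2 hℓ)
  refine ⟨d, hd, fun z hz x hx => ?_⟩
  have := (abs_lt.1 (h hx)).1
  have hz' : ℓ₀ ≤ w z 0 := hz
  linarith

/-- The superlevel set `{w(·, 0) ≥ ℓ₀}` stays in `{w(·, t) ≥ ℓ₀}`. -/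
theorem superlevel_persists (hw : IsSupersolutionWithSpeed w S)
    (hc : ContinuousOn (Function.uncurry w) (univ ×ˢ Ici (0 : ℝ)))
    (hu : UniformContinuous fun x => w x 0) (hV : 0 < V) (hSV : ∀ x t, S x t ≤ V)
    (hΦ : ∀ r, 0 < r → 0 ≤ Φ r)
    (hS : ∀ ℓ < ℓ₀, ∀ t, 0 < t → ∀ r, 0 < r →
      (∀ z ∈ {z | ℓ₀ ≤ w z 0}, ∀ x ∈ Metric.ball z r, ℓ ≤ w x t) →
      ∀ x, w x t < ℓ → S x t ≤ -Φ (r / 2))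
    {t : ℝ} (ht : 0 < t) {z : EuclideanSpace ℝ (Fin n)} (hz : ℓ₀ ≤ w z 0) : ℓ₀ ≤ w z t := by
  refine le_of_forall_lt_imp_le_of_dense fun ℓ hℓ => ?_
  obtain ⟨d, hd, h⟩ := exists_initial_separation hu hℓ
  have hΦ' : ∀ r, 0 < r → 0 ≤ Φ (r / 2) := fun r hr => hΦ _ (half_pos hr)
  refine separation_propagation hw hc hV hSV (φ := fun r => Φ (r / 2)) hΦ' (hS ℓ hℓ)
    (g := fun _ => d) continuousOn_const (fun _ _ => hd) (fun s _ => ?_) h ht.le z hz z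
    (Metric.mem_ball_self hd)
  filter_upwards [self_mem_nhdsWithin] with s' hs'
  have := mul_nonneg (hΦ' (d / 2) (half_pos hd)) (sub_nonneg.2 (le_of_lt hs'))
  linarith

/-- If the rate has root growth, `{w(·, t) ≥ ℓ₀}` contains a neighbourhood of uniform width of
`{w(·, 0) ≥ ℓ₀}`. -/
theorem superlevel_expands (hw : IsSupersolutionWithSpeed w S)
    (hc : ContinuousOn (Function.uncurry w) (univ ×ˢ Ici (0 : ℝ)))
    (hu : UniformContinuous fun x => w x 0) (hV : 0 < V) (hSV : ∀ x t, S x t ≤ V)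
    (hΦ : ∀ r, 0 < r → 0 ≤ Φ r)
    (hS : ∀ ℓ < ℓ₀, ∀ t, 0 < t → ∀ r, 0 < r →
      (∀ z ∈ {z | ℓ₀ ≤ w z 0}, ∀ x ∈ Metric.ball z r, ℓ ≤ w x t) →
      ∀ x, w x t < ℓ → S x t ≤ -Φ (r / 2))
    (hgrow : HasRootGrowth Φ) {t : ℝ} (ht : 0 < t) :
    ∃ ε > 0, ∀ z, ℓ₀ ≤ w z 0 → ∀ x ∈ Metric.ball z ε, ℓ₀ ≤ w x t := by
  obtain ⟨α, C, s₁, hα₀, hα₁, hC, hs₁, hΦ₁⟩ := hgrow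
  obtain ⟨κ, β, hκ, hβ, hp⟩ := exists_power_subsolution (T := t + 1) hα₀ hα₁ hC hs₁
  have hΦ' : ∀ r, 0 < r → 0 ≤ Φ (r / 2) := fun r hr => hΦ _ (half_pos hr)
  refine ⟨κ * t ^ β, by positivity, fun z hz x hx => le_of_forall_lt_imp_le_of_dense fun ℓ hℓ => ?_⟩
  obtain ⟨d, hd, h⟩ := exists_initial_separation hu hℓ
  -- The time shift `σ` makes `g 0 = κ σ ^ β` positive but smaller than `d`. Only `σ` depends on
  -- `ℓ`; the final radius is at least `κ t ^ β`.
  have hsmall : ∀ᶠ σ : ℝ in 𝓝[>] 0, κ * σ ^ β < d := by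
    have : Tendsto (fun σ : ℝ => κ * σ ^ β) (𝓝 0) (𝓝 (κ * 0 ^ β)) :=
      (Real.continuousAt_rpow_const 0 β (Or.inr (by linarith))).tendsto.const_mul _
    rw [Real.zero_rpow (by linarith), mul_zero] at this
    exact (this.mono_left nhdsWithin_le_nhds).eventually (gt_mem_nhds hd)
  obtain ⟨σ, hσd, hσ⟩ := (hsmall.and (Ioo_mem_nhdsGT (one_pos : (0 : ℝ) < 1))).exists
  have hder : ∀ s, HasDerivAt (fun s : ℝ => κ * (s + σ) ^ β) (κ * (β * (s + σ) ^ (β - 1))) s := by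
    intro s
    have := ((hasDerivAt_id s).add_const σ).rpow_const (p := β) (Or.inr hβ.le)
    simpa using this.const_mul κ
  refine separation_propagation hw hc hV hSV (φ := fun r => Φ (r / 2)) hΦ' (hS ℓ hℓ)
    (g := fun s => κ * (s + σ) ^ β) (fun s _ => (hder s).continuousAt.continuousWithinAt)
    (fun s hs => ?_) (fun s hs => ?_) ?_ ht.le z hz x ?_
  · have : 0 < s + σ := by linarith [hs.1, hσ.1]
    positivity
  · have hsσ : 0 < s + σ := by linarith [hs.1, hσ.1]
    obtain ⟨h1, h2⟩ := hp (s + σ) hsσ (by linarith [hs.2, hσ.2])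
    have hg : 0 < κ * (s + σ) ^ β := by positivity
    -- One factor 1/2 comes from the halved separation in `separation_propagation`, the other from
    -- `Φ (r / 2)` in the speed bound.
    have h3 : κ * (β * (s + σ) ^ (β - 1)) < Φ (κ * (s + σ) ^ β / 2 / 2) := by
      refine h2.trans_le ?_
      have := hΦ₁ (κ * (s + σ) ^ β / 4) (by positivity) (by linarith)
      rwa [show κ * (s + σ) ^ β / 2 / 2 = κ * (s + σ) ^ β / 4 by ring]
    have h4 := (hasDerivAt_iff_tendsto_slope.1 (hder s)).mono_left
      (nhdsWithin_mono s fun y (hy : s < y) => ne_of_gt hy)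
    filter_upwards [h4.eventually (gt_mem_nhds h3), self_mem_nhdsWithin] with y hy hys
    have hys' : 0 < y - s := sub_pos.2 hys
    rw [slope_def_field, div_lt_iff₀ hys'] at hy
    linarith
  · intro z hz x hx
    refine h z hz x (Metric.ball_subset_ball ?_ hx)
    simpa using hσd.le
  · refine Metric.ball_subset_ball ?_ hx
    have := Real.rpow_le_rpow ht.le (by linarith [hσ.1] : t ≤ t + σ) (by linarith : 0 ≤ β)
    gcongr

end Separation

/-! ### Parallel sets and monotonicity of the speed -/

section ParallelSets

variable {n : ℕ} {u₀ : EuclideanSpace ℝ (Fin n) → ℝ} {h : ℝ}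

theorem mass_mono {Θ : EuclideanSpace ℝ (Fin n) → ℝ} (hΘ : IsAdmissibleDensity Θ)
    {A B : Set (EuclideanSpace ℝ (Fin n))} (hAB : A ⊆ B) : mass Θ A ≤ mass Θ B := by
  have : IsFiniteMeasure (volume.withDensity fun x => ENNReal.ofReal (Θ x)) :=
    isFiniteMeasure_withDensity_ofReal hΘ.integrable.2
  exact ENNReal.toNNReal_mono (measure_ne_top _ _) (measure_mono hAB)

theorem IsAdmissibleSpeed.le_of_le {f : ℝ → ℝ≥0 → ℝ} (hf : IsAdmissibleSpeed f) {r₁ r₂ : ℝ}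
    {q₁ q₂ : ℝ≥0} (hr : r₁ ≤ r₂) (hq : q₁ ≤ q₂) : f r₁ q₁ ≤ f r₂ q₂ := by
  have h1 : f r₁ q₁ ≤ f r₁ q₂ :=
    (show StrictMono (f r₁) from fun a b => hf.strictMono r₁ a b).monotone hq
  rcases hr.eq_or_lt with rfl | hr
  · exact h1
  · exact h1.trans (hf.mono _ _ _ hr)

theorem parallelD_mono {s₁ s₂ : ℝ} (hs : s₁ ≤ s₂) : parallelD u₀ h s₁ ⊆ parallelD u₀ h s₂ :=
  fun _ hx => lt_of_lt_of_le hx (EReal.coe_le_coe_iff.2 hs)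

theorem parallelE_mono {s₁ s₂ : ℝ} (hs : s₁ ≤ s₂) : parallelE u₀ h s₁ ⊆ parallelE u₀ h s₂ :=
  fun _ hx => le_trans hx (EReal.coe_le_coe_iff.2 hs)

theorem signedDistTo_of_mem {A : Set (EuclideanSpace ℝ (Fin n))} {x : EuclideanSpace ℝ (Fin n)}
    (hx : x ∈ A) : signedDistTo A x = -(Metric.infEDist x Aᶜ : EReal) := by
  rw [signedDistTo, Metric.infEDist_zero_of_mem hx]
  simp

theorem signedDistTo_of_notMem {A : Set (EuclideanSpace ℝ (Fin n))}
    {x : EuclideanSpace ℝ (Fin n)} (hx : x ∉ A) :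
    signedDistTo A x = (Metric.infEDist x A : EReal) := by
  rw [signedDistTo, Metric.infEDist_zero_of_mem (mem_compl hx)]
  simp

theorem parallelD_subset {s : ℝ} (hs : s ≤ 0) : parallelD u₀ h s ⊆ {x | u₀ x < h} := by
  intro x hx
  by_contra hxA
  have hx' : signedDistTo {y | u₀ y < h} x < (s : EReal) := hx
  rw [signedDistTo_of_notMem hxA] at hx'
  exact absurd (hx'.trans_le (EReal.coe_le_coe_iff.2 hs)) (not_lt.2 (EReal.coe_ennreal_nonneg _))

theorem subset_parallelE {s : ℝ} (hs : 0 ≤ s) : {x | u₀ x ≤ h} ⊆ parallelE u₀ h s := by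
  intro x hx
  change signedDistTo {y | u₀ y ≤ h} x ≤ (s : EReal)
  rw [signedDistTo_of_mem hx]
  exact (EReal.neg_le_zero.2 (EReal.coe_ennreal_nonneg _)).trans (EReal.coe_le_coe_iff.2 hs)

/-- Distance at least `r` gives only `sd ≤ -r`, while `D_h` is defined by a strict inequality; hence
the room `s < r`. -/
theorem mem_parallelD_neg {s r : ℝ} (hr : 0 < r) (hs : s < r) {x : EuclideanSpace ℝ (Fin n)}
    (hx : ∀ z, h ≤ u₀ z → r ≤ dist x z) : x ∈ parallelD u₀ h (-s) := by
  have hxA : x ∈ {y | u₀ y < h} := by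
    by_contra hxA
    have := hx x (not_lt.1 hxA)
    rw [dist_self] at this
    linarith
  change signedDistTo {y | u₀ y < h} x < ((-s : ℝ) : EReal)
  rw [signedDistTo_of_mem hxA, EReal.coe_neg, EReal.neg_lt_neg_iff]
  have h1 : ENNReal.ofReal r ≤ Metric.infEDist x {y | u₀ y < h}ᶜ := by
    refine Metric.le_infEDist.2 fun z hz => ?_
    rw [edist_dist]
    exact ENNReal.ofReal_le_ofReal (hx z (not_lt.1 hz))
  have h2 : ((r : ℝ) : EReal) ≤ (Metric.infEDist x {y | u₀ y < h}ᶜ : EReal) := by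
    have := EReal.coe_ennreal_le_coe_ennreal_iff.2 h1
    rwa [EReal.coe_ennreal_ofReal, max_eq_left hr.le] at this
  exact (EReal.coe_lt_coe_iff.2 hs).trans_le h2

theorem exists_dist_lt_of_mem_parallelE {s r : ℝ} (hr : 0 < r) (hs : s < r)
    {x : EuclideanSpace ℝ (Fin n)} (hx : x ∈ parallelE u₀ h s) :
    ∃ z, u₀ z ≤ h ∧ dist x z < r := by
  by_cases hxB : x ∈ {y | u₀ y ≤ h}
  · exact ⟨x, hxB, by simpa using hr⟩
  · have hx' : signedDistTo {y | u₀ y ≤ h} x ≤ (s : EReal) := hx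
    rw [signedDistTo_of_notMem hxB] at hx'
    have h1 : Metric.infEDist x {y | u₀ y ≤ h} < ENNReal.ofReal r := by
      rw [← EReal.coe_ennreal_lt_coe_ennreal_iff, EReal.coe_ennreal_ofReal, max_eq_left hr.le]
      exact hx'.trans_lt (EReal.coe_lt_coe_iff.2 hs)
    obtain ⟨z, hz, hzr⟩ := Metric.infEDist_lt_iff.1 h1
    rw [edist_dist] at hzr
    exact ⟨z, hz, (ENNReal.ofReal_lt_ofReal_iff hr).1 hzr⟩

/-- The complement is empty, so its distance is `+∞` and the signed distance is `-∞` everywhere. -/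
theorem parallelD_eq_univ (hA : {x | u₀ x < h} = univ) (s : ℝ) : parallelD u₀ h s = univ := by
  refine eq_univ_of_forall fun x => ?_
  have hx : x ∈ {x | u₀ x < h} := hA ▸ mem_univ x
  change signedDistTo {y | u₀ y < h} x < (s : EReal)
  rw [signedDistTo_of_mem hx, hA, compl_univ, Metric.infEDist_empty]
  simp

end ParallelSets

/-! ### Extremal evolutions and their signs -/

section Growth

variable {n : ℕ} {f : ℝ → ℝ≥0 → ℝ} {Θ u₀ : EuclideanSpace ℝ (Fin n) → ℝ} {h : ℝ}

theorem FastDecayD.hasRootGrowth (hD : FastDecayD f Θ u₀ h) :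
    HasRootGrowth fun s => -f h (mass Θ (parallelD u₀ h (-s))) := by
  obtain ⟨α, C, hα₀, hα₁, hC, hlim⟩ := hD
  have hlt := eventually_lt_of_limsup_lt
    (hlim.trans_lt (EReal.coe_lt_coe_iff.2 (by linarith : -C < -(C / 2))))
  obtain ⟨s₁, hs₁, hsub⟩ := mem_nhdsGT_iff_exists_Ioo_subset.1 hlt
  refine ⟨α, C / 2, s₁, hα₀, hα₁, by linarith, hs₁, fun s hs hss => ?_⟩
  have h1 : f h (mass Θ (parallelD u₀ h (-s))) / s ^ α < -(C / 2) :=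
    EReal.coe_lt_coe_iff.1 (hsub ⟨hs, hss⟩)
  rw [div_lt_iff₀ (by positivity)] at h1
  linarith

theorem FastGrowthE.hasRootGrowth (hE : FastGrowthE f Θ u₀ h) :
    HasRootGrowth fun s => f h (mass Θ (parallelE u₀ h s)) := by
  obtain ⟨α, C, hα₀, hα₁, hC, hlim⟩ := hE
  have hlt := eventually_lt_of_lt_liminf
    ((EReal.coe_lt_coe_iff.2 (by linarith : C / 2 < C)).trans_le hlim)
  obtain ⟨s₁, hs₁, hsub⟩ := mem_nhdsGT_iff_exists_Ioo_subset.1 hlt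
  refine ⟨α, C / 2, s₁, hα₀, hα₁, by linarith, hs₁, fun s hs hss => ?_⟩
  have h1 : C / 2 < f h (mass Θ (parallelE u₀ h s)) / s ^ α :=
    EReal.coe_lt_coe_iff.1 (hsub ⟨hs, hss⟩)
  rw [lt_div_iff₀ (by positivity)] at h1
  linarith

theorem HasRootGrowth.mono {Φ Ψ : ℝ → ℝ} (hΦ : HasRootGrowth Φ) (h : ∀ s, Φ s ≤ Ψ s) :
    HasRootGrowth Ψ := by
  obtain ⟨α, C, s₁, h1, h2, h3, h4, h5⟩ := hΦ
  exact ⟨α, C, s₁, h1, h2, h3, h4, fun s hs hss => (h5 s hs hss).trans (h s)⟩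

theorem HasRootGrowth.exists_pos {Φ : ℝ → ℝ} (hΦ : HasRootGrowth Φ) : ∃ s > 0, 0 < Φ s := by
  obtain ⟨α, C, s₁, -, -, hC, hs₁, hb⟩ := hΦ
  refine ⟨s₁ / 2, by positivity, lt_of_lt_of_le ?_ (hb _ (by positivity) (by linarith))⟩
  positivity

/-- The minimal solution for the family `D`, with its sign. -/
theorem exists_minimal_evolution (hf : IsAdmissibleSpeed f) (hΘ : IsAdmissibleDensity Θ)
    (hcrit : f h (mass Θ {x | u₀ x < h}) ≤ 0) :
    ∃ δ, IsMinimalEvolution f Θ h (parallelD u₀ h) δ ∧ (∀ t, δ t ≤ 0) ∧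
      (FastDecayD f Θ u₀ h → ∀ t, 0 < t → δ t < 0) := by
  obtain ⟨M, hM⟩ := hf.bounded
  -- This is the speed for `-δ`. Only the lower bound on `δ'` matters for minimality, and the
  -- minimal solution attains it with equality almost everywhere.
  set G : ℝ → ℝ := fun s => -f h (mass Θ (interior (parallelD u₀ h (-s)))) with hG
  have hGmono : Monotone G := fun a b hab => neg_le_neg (hf.le_of_le le_rfl
    (mass_mono hΘ (interior_mono (parallelD_mono (neg_le_neg hab)))))
  have hG0 : 0 ≤ G 0 := neg_nonneg.2 ((hf.le_of_le le_rfl (mass_mono hΘ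
    (interior_subset.trans (parallelD_subset (by simp))))).trans hcrit)
  obtain ⟨ρ, ⟨K, hK⟩, hρ0, hρ, hρd, hmax⟩ := exists_maximal_solution G hGmono hG0 M
    fun s => (neg_le_abs _).trans (hM _ _)
  refine ⟨fun t => -ρ t, ⟨⟨⟨K, hK.neg⟩, by simp [hρ0], ?_⟩, ?_⟩, fun t => by simp [hρ t], ?_⟩
  · filter_upwards [hρd] with t ht ht0
    refine ⟨_, (ht ht0).neg, ?_, ?_⟩
    · simp [hG]
    · simp only [hG, neg_neg]
      exact hf.le_of_le le_rfl (mass_mono hΘ (interior_subset.trans subset_closure))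
  · rintro η ⟨⟨L, hL⟩, hη0, hη⟩ t ht
    have := hmax (fun t => -η t) ⟨L, hL.neg⟩ (by simp [hη0]) (by
      filter_upwards [hη] with s hs hs0
      obtain ⟨v, hv, hv1, -⟩ := hs hs0
      exact ⟨-v, hv.neg, by simpa [hG] using hv1⟩) t ht
    linarith
  · intro hD t ht
    have hgrow : HasRootGrowth G := hD.hasRootGrowth.mono fun s => neg_le_neg
      (hf.le_of_le le_rfl (mass_mono hΘ interior_subset))
    exact neg_neg_of_pos (pos_of_dominates_subsolutions hG0 hGmono hmax hgrow ht)

/-- The maximal solution for the family `E`, with its sign. -/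
theorem exists_maximal_evolution (hf : IsAdmissibleSpeed f) (hΘ : IsAdmissibleDensity Θ)
    (hcrit : 0 ≤ f h (mass Θ {x | u₀ x ≤ h})) :
    ∃ δ, IsMaximalEvolution f Θ h (parallelE u₀ h) δ ∧ (∀ t, 0 ≤ δ t) ∧
      (FastGrowthE f Θ u₀ h → ∀ t, 0 < t → 0 < δ t) := by
  obtain ⟨M, hM⟩ := hf.bounded
  set G : ℝ → ℝ := fun s => f h (mass Θ (closure (parallelE u₀ h s))) with hG
  have hGmono : Monotone G := fun a b hab => hf.le_of_le le_rfl
    (mass_mono hΘ (closure_mono (parallelE_mono hab)))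
  have hG0 : 0 ≤ G 0 := hcrit.trans (hf.le_of_le le_rfl (mass_mono hΘ
    ((subset_parallelE le_rfl).trans subset_closure)))
  obtain ⟨ρ, hK, hρ0, hρ, hρd, hmax⟩ := exists_maximal_solution G hGmono hG0 M
    fun s => (le_abs_self _).trans (hM _ _)
  refine ⟨ρ, ⟨⟨hK, hρ0, ?_⟩, ?_⟩, hρ, ?_⟩
  · filter_upwards [hρd] with t ht ht0
    exact ⟨_, ht ht0, hf.le_of_le le_rfl (mass_mono hΘ (interior_subset.trans subset_closure)),
      le_rfl⟩
  · rintro η ⟨hL, hη0, hη⟩ t ht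
    refine hmax η hL hη0 ?_ t ht
    filter_upwards [hη] with s hs hs0
    obtain ⟨v, hv, -, hv2⟩ := hs hs0
    exact ⟨v, hv, hv2⟩
  · intro hE t ht
    have hgrow : HasRootGrowth G := hE.hasRootGrowth.mono fun s =>
      hf.le_of_le le_rfl (mass_mono hΘ subset_closure)
    exact pos_of_dominates_subsolutions hG0 hGmono hmax hgrow ht

end Growth

/-! ### Fattening of the critical level set -/

section LevelSets

variable {n : ℕ} {f : ℝ → ℝ≥0 → ℝ} {Θ u₀ : EuclideanSpace ℝ (Fin n) → ℝ} {h : ℝ}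
  {u : EuclideanSpace ℝ (Fin n) → ℝ → ℝ}

/-- Since `|∇u|` is even, changing the sign of `u` reverses the speed, and one propagation theory
for supersolutions serves both sides. -/
theorem IsViscositySubsolution.neg (hu : IsViscositySubsolution f Θ u) :
    IsSupersolutionWithSpeed (fun x t => -u x t)
      (fun x t => -f (u x t) (mass Θ {y | u y t < u x t})) := by
  intro φ hφ x t ht hmin
  have hmax : IsLocalMax (fun p : EuclideanSpace ℝ (Fin n) × ℝ => u p.1 p.2 - -φ p) (x, t) := by
    filter_upwards [hmin] with p hp
    linarith
  have h1 := hu.test (fun p => -φ p) hφ.neg x t ht hmax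
  have h2 : gradient (fun y => -φ (y, t)) x = -gradient (fun y => φ (y, t)) x := by
    rw [gradient, gradient, fderiv_fun_neg, map_neg]
  rw [h2, norm_neg, deriv.fun_neg] at h1
  linarith

/-- At a point `x` with `u x t < ℓ`, the set `{u(·,t) ≤ u x t}` lies in `{u(·,t) < ℓ}`, which the
separation places inside `D_h(-r/2)`. As `u x t < h`, monotonicity of `f` in both variables
concludes. -/
theorem rate_bound_D (hf : IsAdmissibleSpeed f) (hΘ : IsAdmissibleDensity Θ)
    (hu0 : ∀ x, u x 0 = u₀ x) :
    ∀ ℓ < h, ∀ t : ℝ, 0 < t → ∀ r : ℝ, 0 < r →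
      (∀ z ∈ {z | h ≤ u z 0}, ∀ x ∈ Metric.ball z r, ℓ ≤ u x t) →
      ∀ x, u x t < ℓ → f (u x t) (mass Θ {y | u y t ≤ u x t}) ≤
        - -f h (mass Θ (parallelD u₀ h (-(r / 2)))) := by
  intro ℓ hℓ t _ r hr hsep x hx
  rw [neg_neg]
  refine hf.le_of_le (hx.trans hℓ).le (mass_mono hΘ fun y hy => ?_)
  refine mem_parallelD_neg hr (half_lt_self hr) fun z hz => ?_
  by_contra! hd
  have h1 := hsep z (by simpa [hu0] using hz) y hd
  exact absurd (h1.trans hy) (not_le.2 hx)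

/-- Here `u x t > -ℓ > h`. Each point of `E_h(r/2)` is within `r` of `{u₀ ≤ h}`, so `u ≤ -ℓ` there;
thus `E_h(r/2)` lies in `{u(·,t) < u x t}`. -/
theorem rate_bound_E (hf : IsAdmissibleSpeed f) (hΘ : IsAdmissibleDensity Θ)
    (hu0 : ∀ x, u x 0 = u₀ x) :
    ∀ ℓ < -h, ∀ t : ℝ, 0 < t → ∀ r : ℝ, 0 < r →
      (∀ z ∈ {z | -h ≤ -u z 0}, ∀ x ∈ Metric.ball z r, ℓ ≤ -u x t) →
      ∀ x, -u x t < ℓ → -f (u x t) (mass Θ {y | u y t < u x t}) ≤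
        -f h (mass Θ (parallelE u₀ h (r / 2))) := by
  intro ℓ hℓ t _ r hr hsep x hx
  refine neg_le_neg (hf.le_of_le (by linarith) (mass_mono hΘ fun y hy => ?_))
  obtain ⟨z, hz, hd⟩ := exists_dist_lt_of_mem_parallelE hr (half_lt_self hr) hy
  have h1 := hsep z (by simpa [hu0] using hz) y hd
  change u y t < u x t
  linarith

/-- Coercivity: if `u₀ ≤ h` everywhere, then `u₀ < h` everywhere. -/
theorem IsAdmissibleInitial.lt_of_forall_le (hn : 1 ≤ n) (hu₀ : IsAdmissibleInitial u₀)
    (hle : ∀ x, u₀ x ≤ h) (x : EuclideanSpace ℝ (Fin n)) : u₀ x < h := by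
  obtain ⟨L, hL, hlt⟩ := hu₀.coercive
  have : Nonempty (Fin n) := ⟨⟨0, hn⟩⟩
  have hLh : L ≤ (h : EReal) := by
    refine le_of_tendsto hL (Eventually.of_forall fun R => ?_)
    obtain ⟨y, hy⟩ := NormedSpace.exists_lt_norm ℝ (EuclideanSpace ℝ (Fin n)) R
    exact (iInf₂_le y hy.le).trans (EReal.coe_le_coe_iff.2 (hle y))
  exact EReal.coe_lt_coe_iff.1 ((hlt x).trans_le hLh)

/-- The critical level set of a solution has nonempty interior at positive times. -/
theorem interior_level_nonempty (hn : 1 ≤ n) (hf : IsAdmissibleSpeed f)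
    (hΘ : IsAdmissibleDensity Θ) (hu₀ : IsAdmissibleInitial u₀)
    (hcrit : IsCriticalLevel f Θ u₀ h) (hu : IsSolution f Θ u₀ u)
    (hfat : (FastDecayD f Θ u₀ h ∧ (interior {x | u₀ x ≤ h}).Nonempty) ∨ FastGrowthE f Θ u₀ h)
    {t : ℝ} (ht : 0 < t) : (interior {x | u x t = h}).Nonempty := by
  obtain ⟨M, hM⟩ := hf.bounded
  have hV : 0 < max M 1 := lt_max_of_lt_right one_pos
  have hu0 := hu.initial
  have hfun0 : (fun x => u x 0) = u₀ := funext hu0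
  have hu_unif : UniformContinuous fun x => u x 0 := hfun0 ▸ hu₀.uniformContinuous
  have hcont : Continuous u₀ := hu₀.uniformContinuous.continuous
  have hsup : IsSupersolutionWithSpeed u fun x t => f (u x t) (mass Θ {y | u y t ≤ u x t}) :=
    hu.supersolution.test
  have hsub := hu.subsolution.neg
  have hVD : ∀ x t, f (u x t) (mass Θ {y | u y t ≤ u x t}) ≤ max M 1 := fun x t =>
    ((le_abs_self _).trans (hM _ _)).trans (le_max_left _ _)
  have hVE : ∀ x t, -f (u x t) (mass Θ {y | u y t < u x t}) ≤ max M 1 := fun x t =>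
    ((neg_le_abs _).trans (hM _ _)).trans (le_max_left _ _)
  have hΦD : ∀ r : ℝ, 0 < r → 0 ≤ -f h (mass Θ (parallelD u₀ h (-r))) := fun r hr =>
    neg_nonneg.2 ((hf.le_of_le le_rfl (mass_mono hΘ (parallelD_subset (by linarith)))).trans
      hcrit.1)
  have hΦE : ∀ r : ℝ, 0 < r → 0 ≤ f h (mass Θ (parallelE u₀ h r)) := fun r hr =>
    hcrit.2.trans (hf.le_of_le le_rfl (mass_mono hΘ (subset_parallelE hr.le)))
  have hlow : ∀ z, h ≤ u₀ z → h ≤ u z t := fun z hz =>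
    superlevel_persists hsup hu.continuousOn hu_unif hV hVD
      (Φ := fun r => -f h (mass Θ (parallelD u₀ h (-r)))) hΦD (rate_bound_D hf hΘ hu0) ht
      (by rwa [hu0])
  have hup : ∀ z, u₀ z ≤ h → u z t ≤ h := fun z hz => neg_le_neg_iff.1 <|
    superlevel_persists hsub hu.continuousOn.neg hu_unif.neg hV hVE
      (Φ := fun r => f h (mass Θ (parallelE u₀ h r))) hΦE (rate_bound_E hf hΘ hu0) ht
      (neg_le_neg_iff.2 (by rwa [hu0]))
  rcases hfat with ⟨hD, hint⟩ | hE
  · obtain ⟨ε, hε, hexp⟩ := superlevel_expands hsup hu.continuousOn hu_unif hV hVD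
      (Φ := fun r => -f h (mass Θ (parallelD u₀ h (-r)))) hΦD (rate_bound_D hf hΘ hu0)
      hD.hasRootGrowth ht
    -- Otherwise `D_h(-s)` is the whole space and (1) makes the speed at full mass negative, against
    -- criticality.
    have hne : {x | u₀ x < h} ≠ univ := by
      intro hA
      obtain ⟨s, -, hs⟩ := hD.hasRootGrowth.exists_pos
      have hB : {x | u₀ x ≤ h} = univ :=
        univ_subset_iff.1 (hA.symm.subset.trans fun x (hx : u₀ x < h) => hx.le)
      have h2 := hcrit.2
      rw [hB] at h2
      rw [parallelD_eq_univ hA] at hs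
      linarith
    rcases eq_empty_or_nonempty {x | u₀ x < h} with hA | hA
    · refine hint.mono (interior_mono fun x hx => le_antisymm (hup x hx) (hlow x ?_))
      by_contra! hx'
      exact (hA ▸ (show x ∈ {x | u₀ x < h} from hx') : x ∈ (∅ : Set _))
    · have hopen : IsOpen {x | u₀ x < h} := isOpen_lt hcont continuous_const
      -- The frontier point satisfies `u₀ z ≥ h`, so `u(·,t) ≥ h` on its `ε`-ball, while `u(·,t) ≤
      -- h` on the part of the ball in `{u₀ < h}`.
      obtain ⟨z, hz⟩ := nonempty_frontier_iff.2 ⟨hA, hne⟩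
      have hzA : z ∉ {x | u₀ x < h} := (hopen.frontier_eq ▸ hz).2
      obtain ⟨y, hyA, hy⟩ := Metric.mem_closure_iff.1 (frontier_subset_closure hz) ε hε
      refine ⟨y, interior_maximal (t := Metric.ball z ε ∩ {x | u₀ x < h}) (fun x hx => ?_)
        (Metric.isOpen_ball.inter hopen) ⟨by rwa [Metric.mem_ball, dist_comm], hyA⟩⟩
      exact le_antisymm (hup x (le_of_lt hx.2))
        (hexp z (by rw [hu0]; exact not_lt.1 hzA) x hx.1)
  · obtain ⟨ε, hε, hexp⟩ := superlevel_expands hsub hu.continuousOn.neg hu_unif.neg hV hVE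
      (Φ := fun r => f h (mass Θ (parallelE u₀ h r))) hΦE (rate_bound_E hf hΘ hu0)
      hE.hasRootGrowth ht
    obtain ⟨s, hs0, hs⟩ := hE.hasRootGrowth.exists_pos
    -- If it were empty, `E_h(s)` would be empty too, and (2) would make the speed at zero mass
    -- positive, against criticality.
    have hB : {x | u₀ x ≤ h}.Nonempty := by
      by_contra hB
      have hPE : parallelE u₀ h s ⊆ {x | u₀ x < h} := fun x hx => by
        obtain ⟨z, hz, -⟩ := exists_dist_lt_of_mem_parallelE (lt_add_of_pos_right 0 (by linarith :
          0 < s + 1)) (by linarith : s < 0 + (s + 1)) hx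
        exact absurd ⟨z, hz⟩ hB
      linarith [hcrit.1, hf.le_of_le (le_refl h) (mass_mono hΘ hPE)]
    -- Coercivity enters here: otherwise `{u₀ < h}` is the whole space, and criticality makes the
    -- speed at full mass nonpositive, against (2).
    have hne : {x | u₀ x ≤ h} ≠ univ := by
      intro hB
      have hA : {x | u₀ x < h} = univ := eq_univ_of_forall
        (hu₀.lt_of_forall_le hn fun x => hB.symm.subset (mem_univ x))
      have h1 := hcrit.1
      rw [hA] at h1
      linarith [hf.le_of_le (le_refl h) (mass_mono hΘ (subset_univ (parallelE u₀ h s)))]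
    have hclosed : IsClosed {x | u₀ x ≤ h} := isClosed_le hcont continuous_const
    obtain ⟨z, hz⟩ := nonempty_frontier_iff.2 ⟨hB, hne⟩
    have hzB : z ∈ {x | u₀ x ≤ h} := hclosed.frontier_subset hz
    rw [← frontier_compl] at hz
    obtain ⟨y, hyB, hy⟩ := Metric.mem_closure_iff.1 (frontier_subset_closure hz) ε hε
    refine ⟨y, interior_maximal (t := Metric.ball z ε ∩ {x | u₀ x ≤ h}ᶜ) (fun x hx => ?_)
      (Metric.isOpen_ball.inter hclosed.isOpen_compl) ⟨by rwa [Metric.mem_ball, dist_comm], hyB⟩⟩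
    exact le_antisymm
      (neg_le_neg_iff.1 (hexp z (by rw [hu0]; exact neg_le_neg hzB) x hx.1))
      (hlow x (le_of_lt (not_le.1 hx.2)))

end LevelSets

end NonlocalHJ

theorem theorem3p3 (n : ℕ) (hn : 1 ≤ n)
    (f : ℝ → NNReal → ℝ) (hf : NonlocalHJ.IsAdmissibleSpeed f)
    (Θ : EuclideanSpace ℝ (Fin n) → ℝ) (hΘ : NonlocalHJ.IsAdmissibleDensity Θ)
    (u₀ : EuclideanSpace ℝ (Fin n) → ℝ) (hu₀ : NonlocalHJ.IsAdmissibleInitial u₀)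
    (hbar : ℝ) (hcrit : NonlocalHJ.IsCriticalLevel f Θ u₀ hbar) :
    -- the extremal solutions exist (they are clearly unique on `[0, ∞)`)
    (∃ δD : ℝ → ℝ,
      NonlocalHJ.IsMinimalEvolution f Θ hbar (NonlocalHJ.parallelD u₀ hbar) δD) ∧
    (∃ δE : ℝ → ℝ,
      NonlocalHJ.IsMaximalEvolution f Θ hbar (NonlocalHJ.parallelE u₀ hbar) δE) ∧
    -- their signs
    (∀ δD δE : ℝ → ℝ,
      NonlocalHJ.IsMinimalEvolution f Θ hbar (NonlocalHJ.parallelD u₀ hbar) δD →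
      NonlocalHJ.IsMaximalEvolution f Θ hbar (NonlocalHJ.parallelE u₀ hbar) δE →
      (NonlocalHJ.FastDecayD f Θ u₀ hbar → ∀ t : ℝ, 0 < t → δD t < 0 ∧ 0 ≤ δE t) ∧
      (NonlocalHJ.FastGrowthE f Θ u₀ hbar → ∀ t : ℝ, 0 < t → δD t ≤ 0 ∧ 0 < δE t)) ∧
    -- the critical level set of the solution has nonempty interior
    (∀ u : EuclideanSpace ℝ (Fin n) → ℝ → ℝ, NonlocalHJ.IsSolution f Θ u₀ u →
      ((NonlocalHJ.FastDecayD f Θ u₀ hbar ∧ (interior {x | u₀ x ≤ hbar}).Nonempty) ∨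
        NonlocalHJ.FastGrowthE f Θ u₀ hbar) →
      ∀ t : ℝ, 0 < t → (interior {x | u x t = hbar}).Nonempty) := by
  obtain ⟨δ₁, hmin, hδ₁, hδ₁'⟩ := NonlocalHJ.exists_minimal_evolution hf hΘ hcrit.1
  obtain ⟨δ₂, hmax, hδ₂, hδ₂'⟩ := NonlocalHJ.exists_maximal_evolution hf hΘ hcrit.2
  refine ⟨⟨δ₁, hmin⟩, ⟨δ₂, hmax⟩, fun δD δE hD hE => ⟨fun h t ht => ?_, fun h t ht => ?_⟩,
    fun u hu h t ht => NonlocalHJ.interior_level_nonempty hn hf hΘ hu₀ hcrit hu h ht⟩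
  -- Any minimal solution lies below the constructed one and any maximal solution above it, so the
  -- signs carry over.
  · exact ⟨(hD.2 _ hmin.1 t ht.le).trans_lt (hδ₁' h t ht), (hδ₂ t).trans (hE.2 _ hmax.1 t ht.le)⟩
  · exact ⟨(hD.2 _ hmin.1 t ht.le).trans (hδ₁ t), (hδ₂' h t ht).trans_le (hE.2 _ hmax.1 t ht.le)⟩
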